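/- **Theorem 3.8.** Throughout, $\Lambda$ is an Artin algebra, that is, an algebra which is finitely generated as a module over a commutative Artinian ring $R$; modules are left modules, $\operatorname{mod}\Lambda$ is the category of finitely generated $\Lambda$-modules, and $\operatorname{pd}$, $\operatorname{id}$ denote projective and injective dimension. For $m\ge 1$, $\Lambda$ is an *$m$-Auslander algebra* if $\operatorname{gl.dim}\Lambda\le m+1$ and the terms $I^0(\Lambda),\dots,I^m(\Lambda)$ of the minimal injective resolution of ${}_\Lambda\Lambda$ are projective. A full subcategory $\mathscr C$ of $\operatorname{mod}\Lambda$ is *maximal $m$-orthogonal* if it is functorially finite in $\operatorname{mod}\Lambda$ (every $D\in\operatorname{mod}\Lambda$ has a morphism $D\to C$ with $C\in\mathscr C$ through which every morphism from $D$ to an object of $\mathscr C$ factors, and dually a morphism $C'\to D$ with $C'\in\mathscr C$ through which every morphism from an object of $\mathscr C$ to $D$ factors) and $$\mathscr C=\{X\in\operatorname{mod}\Lambda:\operatorname{Ext}^i_\Lambda(X,C)=0\ \forall C\in\mathscr C,\ 1\le i\le m\}=\{X\in\operatorname{mod}\Lambda:\operatorname{Ext}^i_\Lambda(C,X)=0\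 \forall C\in\mathscr C,\ 1\le i\le m\}.$$ Let $n\ge 2$, let $\Lambda$ be an $(n-1)$-Auslander algebra with $\operatorname{gl.dim}\Lambda=n$ that admits a maximal $(n-1)$-orthogonal subcategory $\mathscr C$ of $\operatorname{mod}\Lambda$, and let $S$ be a simple $\Lambda$-module with $\operatorname{pd}_\Lambda S=n-1$. Then: 1. $S$ is not injective. 2. $1\le\operatorname{id}_\Lambda S\le n-1$ if and only if $\operatorname{Hom}_\Lambda(S,P)=0$ for every indecomposable projective module $P\in\operatorname{mod}\Lambda$ with $\operatorname{id}_\Lambda P=n$. 3. $\operatorname{id}_\Lambda S=n$ if and only if $\operatorname{Hom}_\Lambda(S,P)\ne 0$ for some indecomposable projective module $P\in\operatorname{mod}\Lambda$ with $\operatorname{id}_\Lambda P=n$. -/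

import Mathlib

open CategoryTheory

universe u v

noncomputable section

namespace HigherAuslander

variable (Λ : Type v) [Ring Λ]

/-- The (left) global dimension of a ring: the supremum of the projective dimensions of all
its left modules. The projective dimension of the zero module is `⊥`. -/
def globalDimension : WithBot ℕ∞ :=
  ⨆ M : ModuleCat.{v} Λ, projectiveDimension M

/-- `mod Λ`: the finitely generated left `Λ`-modules, as a full subcategory of all modules. -/
def finitelyGenerated : ObjectProperty (ModuleCat.{v} Λ) :=
  fun M => Module.Finite Λ M

variable {Λ}

/-- An injective resolution `0 ⟶ M ⟶ I⁰ ⟶ I¹ ⟶ ⋯` is minimal if, for every `i`, the kernel of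
`Iⁱ ⟶ Iⁱ⁺¹` is an essential submodule of `Iⁱ`, i.e. it meets every nonzero submodule
nontrivially. As that kernel is the image of `M` for `i = 0` and the image of `Iⁱ⁻¹` for `i > 0`,
this says that each `Iⁱ` is the injective envelope of the corresponding cosyzygy. -/
def IsMinimalResolution {M : ModuleCat.{v} Λ} (I : InjectiveResolution M) : Prop :=
  ∀ (i : ℕ) (N : Submodule Λ (I.cocomplex.X i)),
    N ⊓ LinearMap.ker (I.cocomplex.d i (i + 1)).hom = ⊥ → N = ⊥

variable (Λ) in
/-- The homological condition defining `n`-Auslander algebras: `gl.dim Λ ≤ n + 1` and the terms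
`I⁰(Λ), …, Iⁿ(Λ)` of the minimal injective resolution of the left module `Λ` are projective.
The minimal injective resolution is unique up to isomorphism, so it does not matter which
one is taken. -/
def IsAuslander (n : ℕ) : Prop :=
  globalDimension Λ ≤ ((n + 1 : ℕ) : WithBot ℕ∞) ∧
    ∃ I : InjectiveResolution (ModuleCat.of Λ Λ), IsMinimalResolution I ∧
      ∀ i ≤ n, Projective (I.cocomplex.X i)

/-- A morphism `f : D ⟶ C` with `C` in `𝒞` is a left `𝒞`-approximation of `D` if every morphism
from `D` to an object of `𝒞` factors through `f`. -/
def IsLeftApproximation (𝒞 : ObjectProperty (ModuleCat.{v} Λ)) {D C : ModuleCat.{v} Λ}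
    (f : D ⟶ C) : Prop :=
  𝒞 C ∧ ∀ (C' : ModuleCat.{v} Λ), 𝒞 C' → ∀ g : D ⟶ C', ∃ h : C ⟶ C', f ≫ h = g

/-- A morphism `f : C ⟶ D` with `C` in `𝒞` is a right `𝒞`-approximation of `D` if every morphism
from an object of `𝒞` to `D` factors through `f`. -/
def IsRightApproximation (𝒞 : ObjectProperty (ModuleCat.{v} Λ)) {C D : ModuleCat.{v} Λ}
    (f : C ⟶ D) : Prop :=
  𝒞 C ∧ ∀ (C' : ModuleCat.{v} Λ), 𝒞 C' → ∀ g : C' ⟶ D, ∃ h : C' ⟶ C, h ≫ f = g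

/-- `𝒞` is functorially finite in `𝒟`: every object of `𝒟` has a left and a right
`𝒞`-approximation. -/
def IsFunctoriallyFinite (𝒞 𝒟 : ObjectProperty (ModuleCat.{v} Λ)) : Prop :=
  ∀ D : ModuleCat.{v} Λ, 𝒟 D →
    (∃ (C : ModuleCat.{v} Λ) (f : D ⟶ C), IsLeftApproximation 𝒞 f) ∧
    (∃ (C : ModuleCat.{v} Λ) (f : C ⟶ D), IsRightApproximation 𝒞 f)

/-- The finitely generated `X` with `Extⁱ(X, C) = 0` for all `C` in `𝒞` and `1 ≤ i ≤ n`. -/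
def leftPerp (n : ℕ) (𝒞 : ObjectProperty (ModuleCat.{v} Λ)) : ObjectProperty (ModuleCat.{v} Λ) :=
  fun X => finitelyGenerated Λ X ∧
    ∀ C : ModuleCat.{v} Λ, 𝒞 C → ∀ i : ℕ, 1 ≤ i → i ≤ n → Subsingleton (Abelian.Ext X C i)

/-- The finitely generated `X` with `Extⁱ(C, X) = 0` for all `C` in `𝒞` and `1 ≤ i ≤ n`. -/
def rightPerp (n : ℕ) (𝒞 : ObjectProperty (ModuleCat.{v} Λ)) : ObjectProperty (ModuleCat.{v} Λ) :=
  fun X => finitelyGenerated Λ X ∧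
    ∀ C : ModuleCat.{v} Λ, 𝒞 C → ∀ i : ℕ, 1 ≤ i → i ≤ n → Subsingleton (Abelian.Ext C X i)

/-- `𝒞` is a maximal `n`-orthogonal subcategory of `𝒟`, where `𝒟` consists of finitely generated
modules. -/
structure IsMaximalOrthogonal (n : ℕ) (𝒞 𝒟 : ObjectProperty (ModuleCat.{v} Λ)) : Prop where
  le : 𝒞 ≤ 𝒟
  functoriallyFinite : IsFunctoriallyFinite 𝒞 𝒟
  eq_leftPerp : 𝒞 = leftPerp n 𝒞 ⊓ 𝒟
  eq_rightPerp : 𝒞 = rightPerp n 𝒞 ⊓ 𝒟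

end HigherAuslander

end

/-!
A morphism out of an artinian module to a finitely generated injective (resp. projective) module
can be chosen with least kernel `K`, and then every other such morphism vanishes on `K`. For
injectives, the injective coresolution of `Λ` forces `Extⁱ(K, Λ) = 0` for all `i`, so that `K = 0`
and there are enough finitely generated injectives. For projectives, it shows that every object of
`𝒞` has a projective quotient whose kernel has no nonzero morphism to a projective.

If `id S ≤ m` (where `m = n - 1`), then `Ext¹(E/S, P) = 0` for an embedding of `S` in a finitely
generated injective `E` and every projective `P`, because projectives and injectives lie in `𝒞`. So
a nonzero `S ⟶ P` extends to `E`, and for indecomposable `P` Fitting's lemma makes `P` injective,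
that is `id P ≠ n`.

Conversely, `Extᵐ(S, Λ) ≠ 0` embeds `S` in a projective-injective module `Q`. If `S` has no nonzero
morphism to an indecomposable projective that is not injective, then `S ⟶ Q` is a left
`𝒞`-approximation, so `Ext¹(Q/S, 𝒞) = 0`. Iterating left `𝒞`-approximations turns this into
`Extᵐ(𝒞, Q/S) = 0`, whence `Extⁿ(E, S) = 0` for all finitely generated injective `E` and `id S < n`.
-/

section

open Limits

namespace HigherAuslander

section ExtVanishing

open Abelian

variable {C : Type*} [Category* C] [Abelian C]

lemma shortExact_kernel {X Y : C} (f : X ⟶ Y) [Epi f] :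
    (ShortComplex.mk _ _ (kernel.condition f)).ShortExact where
  exact := ShortComplex.exact_kernel f

lemma shortExact_cokernel {X Y : C} (f : X ⟶ Y) [Mono f] :
    (ShortComplex.mk _ _ (cokernel.condition f)).ShortExact where
  exact := ShortComplex.exact_cokernel f

universe w

variable [HasExt.{w} C] {S : ShortComplex C} {X Y : C} {n : ℕ}

lemma subsingleton_ext_zero_iff : Subsingleton (Ext X Y 0) ↔ ∀ f : X ⟶ Y, f = 0 :=
  ⟨fun _ _ => Ext.homEquiv₀.symm.injective (Subsingleton.elim _ _),
    fun h => ⟨fun _ _ => Ext.homEquiv₀.injective ((h _).trans (h _).symm)⟩⟩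

lemma isZero_of_subsingleton_ext_zero (h : Subsingleton (Ext X X 0)) : IsZero X :=
  (IsZero.iff_id_eq_zero X).2 (subsingleton_ext_zero_iff.1 h _)

lemma subsingleton_ext_to_X₃ (hS : S.ShortExact) (h₂ : Subsingleton (Ext X S.X₂ n))
    (h₁ : Subsingleton (Ext X S.X₁ (n + 1))) : Subsingleton (Ext X S.X₃ n) := by
  refine subsingleton_of_forall_eq 0 fun x => ?_
  obtain ⟨y, rfl⟩ := Ext.covariant_sequence_exact₃ X hS x rfl (Subsingleton.elim _ _)
  rw [Subsingleton.elim y 0, Ext.zero_comp]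

lemma subsingleton_ext_to_X₁ (hS : S.ShortExact) (h₃ : Subsingleton (Ext X S.X₃ n))
    (h₂ : Subsingleton (Ext X S.X₂ (n + 1))) : Subsingleton (Ext X S.X₁ (n + 1)) := by
  refine subsingleton_of_forall_eq 0 fun x => ?_
  obtain ⟨y, rfl⟩ := Ext.covariant_sequence_exact₁ X hS x (Subsingleton.elim _ _) rfl
  rw [Subsingleton.elim y 0, Ext.zero_comp]

lemma subsingleton_ext_from_X₁ (hS : S.ShortExact) (h₂ : Subsingleton (Ext S.X₂ Y n))
    (h₃ : Subsingleton (Ext S.X₃ Y (n + 1))) : Subsingleton (Ext S.X₁ Y n) := by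
  refine subsingleton_of_forall_eq 0 fun x => ?_
  obtain ⟨y, rfl⟩ := Ext.contravariant_sequence_exact₁ hS Y x (add_comm 1 n)
    (Subsingleton.elim _ _)
  rw [Subsingleton.elim y 0, Ext.comp_zero]

lemma subsingleton_ext_from_X₃ (hS : S.ShortExact) (h₁ : Subsingleton (Ext S.X₁ Y n))
    (h₂ : Subsingleton (Ext S.X₂ Y (n + 1))) : Subsingleton (Ext S.X₃ Y (n + 1)) := by
  refine subsingleton_of_forall_eq 0 fun x => ?_
  obtain ⟨y, rfl⟩ := Ext.contravariant_sequence_exact₃ hS Y x (Subsingleton.elim _ _)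
    (add_comm 1 n)
  rw [Subsingleton.elim y 0, Ext.comp_zero]

lemma subsingleton_ext_one_of_extension (hS : S.ShortExact)
    (h : ∀ f : S.X₁ ⟶ Y, ∃ g : S.X₂ ⟶ Y, S.f ≫ g = f) (h₂ : Subsingleton (Ext S.X₂ Y 1)) :
    Subsingleton (Ext S.X₃ Y 1) := by
  refine subsingleton_of_forall_eq 0 fun x => ?_
  obtain ⟨y, rfl⟩ := Ext.contravariant_sequence_exact₃ hS Y x (Subsingleton.elim _ _)
    (add_comm 1 0)
  obtain ⟨f, rfl⟩ := Ext.homEquiv₀.symm.surjective y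
  obtain ⟨g, rfl⟩ := h f
  rw [Ext.homEquiv₀_symm_apply, ← Ext.mk₀_comp_mk₀, hS.extClass_comp_assoc]

lemma exists_extension_of_subsingleton_ext_one (hS : S.ShortExact)
    (h : Subsingleton (Ext S.X₃ Y 1)) (f : S.X₁ ⟶ Y) : ∃ g : S.X₂ ⟶ Y, S.f ≫ g = f := by
  obtain ⟨y, hy⟩ := Ext.contravariant_sequence_exact₁ hS Y (Ext.mk₀ f) (add_comm 1 0)
    (Subsingleton.elim _ _)
  obtain ⟨g, rfl⟩ := Ext.homEquiv₀.symm.surjective y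
  rw [Ext.homEquiv₀_symm_apply, Ext.mk₀_comp_mk₀] at hy
  exact ⟨g, Ext.homEquiv₀.symm.injective hy⟩

lemma exists_lift_of_subsingleton_ext_one (hS : S.ShortExact)
    (h : Subsingleton (Ext X S.X₁ 1)) (f : X ⟶ S.X₃) : ∃ g : X ⟶ S.X₂, g ≫ S.g = f := by
  obtain ⟨y, hy⟩ := Ext.covariant_sequence_exact₃ X hS (Ext.mk₀ f) (zero_add 1)
    (Subsingleton.elim _ _)
  obtain ⟨g, rfl⟩ := Ext.homEquiv₀.symm.surjective y
  rw [Ext.homEquiv₀_symm_apply, Ext.mk₀_comp_mk₀] at hy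
  exact ⟨g, Ext.homEquiv₀.symm.injective hy⟩

lemma subsingleton_ext_of_retract {Z : C} (r : Retract Y Z) (h : Subsingleton (Ext X Z n)) :
    Subsingleton (Ext X Y n) := by
  refine subsingleton_of_forall_eq 0 fun x => ?_
  rw [← x.comp_mk₀_id, ← r.retract, ← Ext.mk₀_comp_mk₀, ← Ext.comp_assoc_of_second_deg_zero,
    Subsingleton.elim (x.comp (Ext.mk₀ r.i) (add_zero n)) 0, Ext.zero_comp]

end ExtVanishing

section Coresolutions

open Abelian

variable {C : Type*} [Category* C] [Abelian C]

/-- `HasCoresolution 𝓔 k M` means that there is an exact sequence `0 ⟶ M ⟶ E⁰ ⟶ ⋯ ⟶ Eᵏ⁻¹` with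
all `Eⁱ` in `𝓔`, encoded as `k` successive embeddings of cosyzygies. -/
inductive HasCoresolution (𝓔 : ObjectProperty C) : ℕ → C → Prop
  | zero (M : C) : HasCoresolution 𝓔 0 M
  | succ {k : ℕ} {S : ShortComplex C} (hS : S.ShortExact) (hE : 𝓔 S.X₂)
      (hZ : HasCoresolution 𝓔 k S.X₃) : HasCoresolution 𝓔 (k + 1) S.X₁

namespace HasCoresolution

variable {𝓔 : ObjectProperty C} {k : ℕ} {M : C}

lemma of_iso {N : C} (e : M ≅ N) (hM : HasCoresolution 𝓔 k M) : HasCoresolution 𝓔 k N := by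
  cases hM with
  | zero => exact .zero N
  | @succ k S hS hE hZ =>
    refine .succ (S := .mk (e.inv ≫ S.f) S.g (by simp)) (ShortComplex.shortExact_of_iso ?_ hS) hE hZ
    exact ShortComplex.isoMk e (Iso.refl _) (Iso.refl _) (by simp) (by simp)

lemma exists_mono (hM : HasCoresolution 𝓔 (k + 1) M) : ∃ (E : C) (f : M ⟶ E), 𝓔 E ∧ Mono f := by
  cases hM with
  | succ hS hE _ => exact ⟨_, _, hE, hS.mono_f⟩

lemma mono {𝓔' : ObjectProperty C} (h : 𝓔 ≤ 𝓔') (hM : HasCoresolution 𝓔 k M) :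
    HasCoresolution 𝓔' k M := by
  induction hM with
  | zero M => exact .zero M
  | succ hS hE _ ih => exact .succ hS (h _ hE) ih

universe w

lemma subsingleton_ext [HasExt.{w} C] (h𝓔 : 𝓔 ≤ isInjective C) (hM : HasCoresolution 𝓔 k M)
    {K : C} (hK : ∀ E, 𝓔 E → ∀ f : K ⟶ E, f = 0) {i : ℕ} (hi : i < k) :
    Subsingleton (Ext K M i) := by
  induction hM generalizing i with
  | zero => exact absurd hi (Nat.not_lt_zero i)
  | @succ k S hS hE _ ih =>
    have := hS.mono_f
    have : Injective S.X₂ := h𝓔 _ hE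
    cases i with
    | zero =>
      exact subsingleton_ext_zero_iff.2 fun f => zero_of_comp_mono S.f (hK _ hE (f ≫ S.f))
    | succ i =>
      exact subsingleton_ext_to_X₁ hS (ih (by lia)) (Ext.subsingleton_of_injective _ _ i)

lemma succ_of_hasInjectiveDimensionLE {𝓓 : ObjectProperty C}
    [𝓓.IsClosedUnderQuotients] (hM : HasCoresolution (𝓓 ⊓ isInjective C) k M) (hM' : 𝓓 M)
    (hid : HasInjectiveDimensionLE M k) : HasCoresolution (𝓓 ⊓ isInjective C) (k + 1) M := by
  induction hM with
  | zero M =>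
    exact .succ (shortExact_cokernel (𝟙 M))
      ⟨hM', injective_iff_hasInjectiveDimensionLT_one.2 hid⟩ (.zero _)
  | @succ k S hS hE _ ih =>
    have := hS.epi_g
    exact .succ hS hE (ih (𝓓.prop_of_epi S.g hE.1)
      ((hS.hasInjectiveDimensionLT_X₃_iff k hE.2).2 hid))

end HasCoresolution

end Coresolutions

section UniversalMap

variable {C : Type*} [Category* C] [Abelian C] {𝓔 : ObjectProperty C}

lemma exists_least_kernel [𝓔.Nonempty] (hsum : ∀ X Y, 𝓔 X → 𝓔 Y → 𝓔 (X ⊞ Y))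
    (M : C) [IsArtinianObject M] :
    ∃ (E : C) (φ : M ⟶ E), 𝓔 E ∧ ∀ {K E' : C} (ι : K ⟶ M) (ψ : M ⟶ E'), 𝓔 E' →
      ι ≫ φ = 0 → ι ≫ ψ = 0 := by
  obtain ⟨E₀, hE₀⟩ := ‹𝓔.Nonempty›
  obtain ⟨_, ⟨E, φ, hE, rfl⟩, hmin⟩ := wellFounded_lt.has_min
    {N : Subobject M | ∃ (E : C) (φ : M ⟶ E), 𝓔 E ∧ kernelSubobject φ = N}
    ⟨_, E₀, 0, hE₀, rfl⟩
  refine ⟨E, φ, hE, fun {K E'} ι ψ hE' hι => ?_⟩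
  let χ : M ⟶ E ⊞ E' := biprod.lift φ ψ
  have hle : kernelSubobject χ ≤ kernelSubobject φ := by
    refine le_kernelSubobject _ _ ?_
    rw [← biprod.lift_fst φ ψ, kernelSubobject_arrow_comp_assoc, zero_comp]
  have hle' : kernelSubobject φ ≤ kernelSubobject χ := by
    by_contra h
    exact hmin _ ⟨_, χ, hsum _ _ hE hE', rfl⟩ (lt_of_le_not_ge hle h)
  have hιχ : ι ≫ χ = 0 := (kernelSubobject_factors_iff χ ι).1
    (Subobject.factors_of_le ι hle' ((kernelSubobject_factors_iff φ ι).2 hι))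
  rw [← biprod.lift_snd φ ψ, ← Category.assoc, hιχ, zero_comp]

end UniversalMap

section FiniteModules

open Abelian

variable {Λ : Type v} [Ring Λ]

lemma finite_of_epi {M N : ModuleCat.{v} Λ} (f : M ⟶ N) [Epi f] [Module.Finite Λ M] :
    Module.Finite Λ N :=
  Module.Finite.of_surjective f.hom ((ModuleCat.epi_iff_surjective f).1 inferInstance)

lemma finite_of_mono [IsNoetherianRing Λ] {M N : ModuleCat.{v} Λ} (f : M ⟶ N) [Mono f]
    [Module.Finite Λ N] : Module.Finite Λ M :=
  Module.Finite.of_injective f.hom ((ModuleCat.mono_iff_injective f).1 inferInstance)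

instance : (finitelyGenerated Λ).IsClosedUnderQuotients where
  prop_of_epi f _ (_ : Module.Finite Λ _) := finite_of_epi f

instance finite_kernel [IsNoetherianRing Λ] {M N : ModuleCat.{v} Λ} (f : M ⟶ N)
    [Module.Finite Λ M] : Module.Finite Λ (kernel f : ModuleCat.{v} Λ) :=
  finite_of_mono (kernel.ι f)

instance finite_cokernel {M N : ModuleCat.{v} Λ} (f : M ⟶ N) [Module.Finite Λ N] :
    Module.Finite Λ (cokernel f : ModuleCat.{v} Λ) :=
  finite_of_epi (cokernel.π f)

instance finite_biprod (M N : ModuleCat.{v} Λ) [Module.Finite Λ M] [Module.Finite Λ N] :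
    Module.Finite Λ (M ⊞ N : ModuleCat.{v} Λ) :=
  Module.Finite.equiv (ModuleCat.biprodIsoProd M N).toLinearEquiv.symm

instance (M : ModuleCat.{v} Λ) [IsArtinian Λ M] : IsArtinianObject M :=
  ⟨(ModuleCat.subobjectModule M).toOrderEmbedding.wellFoundedLT⟩

variable (Λ) in
/-- The finitely generated injective modules. -/
abbrev finiteInjective : ObjectProperty (ModuleCat.{v} Λ) :=
  finitelyGenerated Λ ⊓ isInjective _

variable (Λ) in
/-- The finitely generated projective modules. -/
abbrev finiteProjective : ObjectProperty (ModuleCat.{v} Λ) :=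
  finitelyGenerated Λ ⊓ isProjective _

variable (Λ) in
/-- The finitely generated modules that are both projective and injective. -/
abbrev finiteProjectiveInjective : ObjectProperty (ModuleCat.{v} Λ) :=
  finiteProjective Λ ⊓ isInjective _

instance : (finitelyGenerated Λ).ContainsZero where
  exists_zero := ⟨ModuleCat.of Λ PUnit, ModuleCat.isZero_of_subsingleton _,
    inferInstanceAs (Module.Finite Λ PUnit.{v + 1})⟩

lemma finiteInjective_biprod (E E' : ModuleCat.{v} Λ) :
    finiteInjective Λ E → finiteInjective Λ E' → finiteInjective Λ (E ⊞ E')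
  | ⟨(_ : Module.Finite Λ E), (_ : Injective E)⟩,
    ⟨(_ : Module.Finite Λ E'), (_ : Injective E')⟩ => ⟨finite_biprod E E', inferInstance⟩

lemma finiteProjective_biprod (P P' : ModuleCat.{v} Λ) :
    finiteProjective Λ P → finiteProjective Λ P' → finiteProjective Λ (P ⊞ P')
  | ⟨(_ : Module.Finite Λ P), (_ : Projective P)⟩,
    ⟨(_ : Module.Finite Λ P'), (_ : Projective P')⟩ => ⟨finite_biprod P P', inferInstance⟩

instance projective_free (r : ℕ) : Projective (ModuleCat.of Λ (Fin r → Λ)) :=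
  (IsProjective.iff_projective _).1 inferInstance

instance projective_self : Projective (ModuleCat.of Λ Λ) :=
  (IsProjective.iff_projective _).1 inferInstance

instance : (finiteProjective Λ).Nonempty :=
  ⟨ModuleCat.of Λ Λ, inferInstanceAs (Module.Finite Λ Λ), projective_self⟩

lemma exists_epi_from_free (M : ModuleCat.{v} Λ) [Module.Finite Λ M] :
    ∃ (r : ℕ) (f : ModuleCat.of Λ (Fin r → Λ) ⟶ M), Epi f := by
  obtain ⟨r, f, hf⟩ := Module.Finite.exists_fin' Λ M
  exact ⟨r, ModuleCat.ofHom f, (ModuleCat.epi_iff_surjective _).2 hf⟩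

lemma subsingleton_ext_free {X : ModuleCat.{v} Λ} {n : ℕ}
    (h : Subsingleton (Ext X (ModuleCat.of Λ Λ) n)) (r : ℕ) :
    Subsingleton (Ext X (ModuleCat.of Λ (Fin r → Λ)) n) := by
  let Y : Fin r → ModuleCat.{v} Λ := fun _ => ModuleCat.of Λ Λ
  have : ∀ i, Subsingleton (Ext X (Y i) n) := fun _ => h
  have : Subsingleton (Ext X (⨁ Y) n) :=
    (Ext.addEquivBiproduct X (biproduct.isBilimit Y) n).subsingleton
  exact subsingleton_ext_of_retract (ModuleCat.biproductIsoPi Y).symm.retract this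

lemma subsingleton_ext_projective {X : ModuleCat.{v} Λ} {n : ℕ}
    (h : Subsingleton (Ext X (ModuleCat.of Λ Λ) n)) (P : ModuleCat.{v} Λ)
    [Module.Finite Λ P] [Projective P] : Subsingleton (Ext X P n) := by
  obtain ⟨r, f, _⟩ := exists_epi_from_free P
  exact subsingleton_ext_of_retract ⟨Projective.factorThru (𝟙 P) f, f, by simp⟩
    (subsingleton_ext_free h r)

lemma hasProjectiveDimensionLE_of_forall_finite [IsNoetherianRing Λ] (k : ℕ)
    (M : ModuleCat.{v} Λ) [Module.Finite Λ M]
    (h : ∀ N : ModuleCat.{v} Λ, Module.Finite Λ N → Subsingleton (Ext M N (k + 1))) :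
    HasProjectiveDimensionLE M k := by
  induction k generalizing M with
  | zero =>
    obtain ⟨r, f, _⟩ := exists_epi_from_free M
    obtain ⟨s, hs⟩ := exists_lift_of_subsingleton_ext_one (shortExact_kernel f)
      (h _ (finite_kernel f)) (𝟙 M)
    exact (projective_iff_hasProjectiveDimensionLE_zero M).1 (Retract.projective ⟨s, f, hs⟩)
  | succ k ih =>
    obtain ⟨r, f, _⟩ := exists_epi_from_free M
    have hS := shortExact_kernel f
    exact (hS.hasProjectiveDimensionLT_X₃_iff k (projective_free r)).2 <| ih _ fun N hN =>
      subsingleton_ext_from_X₁ hS (Ext.subsingleton_of_projective _ _ _) (h N hN)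

lemma hasProjectiveDimensionLE_of_subsingleton_ext [IsNoetherianRing Λ] {k : ℕ}
    {M : ModuleCat.{v} Λ} [Module.Finite Λ M] (hM : HasProjectiveDimensionLE M (k + 1))
    (h : Subsingleton (Ext M (ModuleCat.of Λ Λ) (k + 1))) :
    HasProjectiveDimensionLE M k :=
  hasProjectiveDimensionLE_of_forall_finite k M fun N _ => by
    obtain ⟨r, f, _⟩ := exists_epi_from_free N
    exact subsingleton_ext_to_X₃ (shortExact_kernel f) (subsingleton_ext_free h r)
      (hM.subsingleton _ _ _ le_rfl _)

lemma projective_of_subsingleton_ext [IsNoetherianRing Λ] {k : ℕ} {M : ModuleCat.{v} Λ}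
    [Module.Finite Λ M] (hM : HasProjectiveDimensionLE M k)
    (h : ∀ i, 1 ≤ i → i ≤ k → Subsingleton (Ext M (ModuleCat.of Λ Λ) i)) : Projective M := by
  induction k with
  | zero => exact (projective_iff_hasProjectiveDimensionLE_zero M).2 hM
  | succ k ih =>
    exact ih (hasProjectiveDimensionLE_of_subsingleton_ext hM (h _ (by simp) le_rfl))
      fun i hi hik => h i hi (by lia)

lemma isZero_of_subsingleton_ext [IsNoetherianRing Λ] {k : ℕ} {M : ModuleCat.{v} Λ}
    [Module.Finite Λ M] (hM : HasProjectiveDimensionLE M k)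
    (h : ∀ i ≤ k, Subsingleton (Ext M (ModuleCat.of Λ Λ) i)) : IsZero M := by
  have := projective_of_subsingleton_ext hM fun i _ hi => h i hi
  exact isZero_of_subsingleton_ext_zero (subsingleton_ext_projective (h 0 k.zero_le) M)

lemma not_subsingleton_ext_of_projectiveDimension_eq [IsNoetherianRing Λ] {k : ℕ}
    {M : ModuleCat.{v} Λ} [Module.Finite Λ M] (hM : projectiveDimension M = (k : WithBot ℕ∞)) :
    ¬ Subsingleton (Ext M (ModuleCat.of Λ Λ) k) := by
  intro h
  have hle := (projectiveDimension_le_iff M k).1 hM.le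
  cases k with
  | zero =>
    have hM₀ : IsZero M := isZero_of_subsingleton_ext hle fun i hi => Nat.le_zero.1 hi ▸ h
    exact WithBot.bot_ne_coe (((projectiveDimension_eq_bot_iff M).2 hM₀).symm.trans hM)
  | succ k =>
    exact (projectiveDimension_ge_iff M (k + 1)).1 hM.ge
      (hasProjectiveDimensionLE_of_subsingleton_ext hle h)

lemma injective_of_forall_finite (M : ModuleCat.{v} Λ)
    (h : ∀ N : ModuleCat.{v} Λ, Module.Finite Λ N → Subsingleton (Ext N M 1)) : Injective M := by
  refine Module.injective_object_of_injective_module (inj := Module.Baer.injective ?_)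
  intro I f
  let ι : ModuleCat.of Λ I ⟶ ModuleCat.of Λ Λ := ModuleCat.ofHom I.subtype
  have : Mono ι := (ModuleCat.mono_iff_injective ι).2 I.injective_subtype
  obtain ⟨g, hg⟩ := exists_extension_of_subsingleton_ext_one (shortExact_cokernel ι)
    (h _ (finite_cokernel ι)) (ModuleCat.ofHom f)
  exact ⟨g.hom, fun x hx => congr($(hg).hom ⟨x, hx⟩)⟩

lemma hasInjectiveDimensionLE_of_forall_finite (k : ℕ) (M : ModuleCat.{v} Λ)
    (h : ∀ N : ModuleCat.{v} Λ, Module.Finite Λ N → Subsingleton (Ext N M (k + 1))) :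
    HasInjectiveDimensionLE M k := by
  induction k generalizing M with
  | zero => exact injective_iff_hasInjectiveDimensionLT_one.1 (injective_of_forall_finite M h)
  | succ k ih =>
    have hS := shortExact_cokernel (Injective.ι M)
    exact (hS.hasInjectiveDimensionLT_X₃_iff k inferInstance).1 <| ih _ fun N hN =>
      subsingleton_ext_to_X₃ hS (Ext.subsingleton_of_injective _ _ _) (h N hN)

variable (Λ) in
/-- Every finitely generated module embeds in a finitely generated injective module. -/
def HasEnoughFiniteInjectives : Prop :=
  ∀ (M : ModuleCat.{v} Λ) [Module.Finite Λ M],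
    ∃ (E : ModuleCat.{v} Λ) (f : M ⟶ E), finiteInjective Λ E ∧ Mono f

lemma HasEnoughFiniteInjectives.hasInjectiveDimensionLE_of_subsingleton_ext
    (hE : HasEnoughFiniteInjectives Λ) {k : ℕ} {M : ModuleCat.{v} Λ}
    (hM : HasInjectiveDimensionLE M (k + 1))
    (h : ∀ E : ModuleCat.{v} Λ, finiteInjective Λ E → Subsingleton (Ext E M (k + 1))) :
    HasInjectiveDimensionLE M k :=
  hasInjectiveDimensionLE_of_forall_finite k M fun N _ => by
    obtain ⟨E, f, hE', _⟩ := hE N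
    exact subsingleton_ext_from_X₁ (shortExact_cokernel f) (h E hE')
      (hM.subsingleton _ _ _ le_rfl _)

end FiniteModules

section AuslanderAlgebras

variable {Λ : Type v} [Ring Λ]

lemma finite_of_essential [IsNoetherianRing Λ] {I : Type*} [AddCommGroup I] [Module Λ I]
    [Module.Projective Λ I] {N : Submodule Λ I} (hN : N.FG)
    (hess : ∀ N' : Submodule Λ I, N' ⊓ N = ⊥ → N' = ⊥) : Module.Finite Λ I := by
  obtain ⟨s, hs⟩ := Module.projective_def.1 (inferInstance : Module.Projective Λ I)
  obtain ⟨G, rfl⟩ := hN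
  classical
  -- The section `s : I → ⨁ Λ` followed by the projection to the finitely many summands that meet
  -- `s N` is injective on `N`, hence on `I`.
  let T : Finset I := G.biUnion fun g => (s g).support
  let r : I →ₗ[Λ] (T → Λ) := LinearMap.pi fun t => Finsupp.lapply t.1 ∘ₗ s
  have hle : Submodule.span Λ (G : Set I) ≤ (Finsupp.supported Λ Λ (T : Set I)).comap s :=
    Submodule.span_le.2 fun g hg _ ht => Finset.mem_coe.2 (Finset.mem_biUnion.2 ⟨g, hg, ht⟩)
  have hr : LinearMap.ker r = ⊥ := by
    refine hess _ ((Submodule.eq_bot_iff _).2 fun x ⟨hxr, hxN⟩ => ?_)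
    have hsx : s x = 0 := by
      ext t
      by_contra h
      exact h (congr_fun (LinearMap.mem_ker.1 hxr) ⟨t, hle hxN (Finsupp.mem_support_iff.2 h)⟩)
    rw [← hs x, hsx, map_zero]
  exact Module.Finite.of_injective r (LinearMap.ker_eq_bot.1 hr)

lemma shortExact_cosyzygy {M : ModuleCat.{v} Λ} (I : InjectiveResolution M) (i : ℕ) :
    (ShortComplex.mk (kernel.ι (I.cocomplex.d i (i + 1)))
      (kernel.lift (I.cocomplex.d (i + 1) (i + 2)) (I.cocomplex.d i (i + 1)) (by simp))
      (by simp [← cancel_mono (kernel.ι _)])).ShortExact where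
  exact := by
    let S := ShortComplex.mk _ _ (kernel.condition (I.cocomplex.d i (i + 1)))
    let φ : ShortComplex.mk (kernel.ι (I.cocomplex.d i (i + 1)))
        (kernel.lift (I.cocomplex.d (i + 1) (i + 2)) (I.cocomplex.d i (i + 1)) (by simp))
        (by simp [← cancel_mono (kernel.ι _)]) ⟶ S :=
      { τ₁ := 𝟙 _, τ₂ := 𝟙 _, τ₃ := kernel.ι _ }
    have : Epi φ.τ₁ := inferInstanceAs (Epi (𝟙 _))
    have : IsIso φ.τ₂ := inferInstanceAs (IsIso (𝟙 _))
    have : Mono φ.τ₃ := inferInstanceAs (Mono (kernel.ι _))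
    exact (ShortComplex.exact_iff_of_epi_of_isIso_of_mono φ).2 (ShortComplex.exact_kernel _)
  epi_g := (I.exact_succ i).epi_kernelLift

lemma IsMinimalResolution.finite_X [IsNoetherianRing Λ] {M : ModuleCat.{v} Λ}
    {I : InjectiveResolution M} (hI : IsMinimalResolution I) (i : ℕ)
    [Projective (I.cocomplex.X i)]
    [Module.Finite Λ (kernel (I.cocomplex.d i (i + 1)) : ModuleCat.{v} Λ)] :
    Module.Finite Λ (I.cocomplex.X i) := by
  have : Module.Finite Λ (LinearMap.ker (I.cocomplex.d i (i + 1)).hom) :=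
    Module.Finite.equiv (ModuleCat.kernelIsoKer (I.cocomplex.d i (i + 1))).toLinearEquiv
  exact finite_of_essential (Module.Finite.iff_fg.1 this) (hI i)

lemma IsMinimalResolution.hasCoresolution_kernel [IsNoetherianRing Λ] {M : ModuleCat.{v} Λ}
    {I : InjectiveResolution M} (hI : IsMinimalResolution I) (k i : ℕ)
    (hproj : ∀ j < i + k, Projective (I.cocomplex.X j))
    [Module.Finite Λ (kernel (I.cocomplex.d i (i + 1)) : ModuleCat.{v} Λ)] :
    HasCoresolution (finiteProjectiveInjective Λ) k (kernel (I.cocomplex.d i (i + 1))) := by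
  induction k generalizing i with
  | zero => exact .zero _
  | succ k ih =>
    have hS := shortExact_cosyzygy I i
    have hP := hproj i (by lia)
    have hX := hI.finite_X i
    have := hS.epi_g
    have := finite_of_epi (kernel.lift (I.cocomplex.d (i + 1) (i + 2))
      (I.cocomplex.d i (i + 1)) (I.complex_d_comp i))
    exact .succ hS ⟨⟨hX, hP⟩, I.injective i⟩ (ih (i + 1) fun j hj => hproj j (by lia))

namespace IsAuslander

variable {m : ℕ} (hΛ : IsAuslander Λ m)

include hΛ

lemma hasCoresolution [IsNoetherianRing Λ] :
    HasCoresolution (finiteProjectiveInjective Λ) (m + 1) (ModuleCat.of Λ Λ) := by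
  obtain ⟨-, I, hI, hproj⟩ := hΛ
  let e : (kernel (I.cocomplex.d 0 1) : ModuleCat.{v} Λ) ≅ ModuleCat.of Λ Λ :=
    (kernelIsKernel _).conePointUniqueUpToIso I.isLimitKernelFork
  have := finite_of_epi e.inv
  exact (hI.hasCoresolution_kernel (m + 1) 0 fun j hj => hproj j (by lia)).of_iso e

lemma hasProjectiveDimensionLE (M : ModuleCat.{v} Λ) : HasProjectiveDimensionLE M (m + 1) :=
  (projectiveDimension_le_iff M _).1 ((le_iSup projectiveDimension M).trans hΛ.1)

lemma hasInjectiveDimensionLE (M : ModuleCat.{v} Λ) : HasInjectiveDimensionLE M (m + 1) :=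
  hasInjectiveDimensionLT_of_enoughProjectives M _ fun Y =>
    (hΛ.hasProjectiveDimensionLE Y).subsingleton _ _ _ le_rfl _

lemma injectiveDimension_eq_iff (M : ModuleCat.{v} Λ) :
    injectiveDimension M = ((m + 1 : ℕ) : WithBot ℕ∞) ↔ ¬ HasInjectiveDimensionLE M m :=
  ⟨fun h => (injectiveDimension_ge_iff M (m + 1)).1 h.ge, fun h =>
    le_antisymm ((injectiveDimension_le_iff M _).2 (hΛ.hasInjectiveDimensionLE M))
      ((injectiveDimension_ge_iff M (m + 1)).2 h)⟩

lemma hasEnoughFiniteInjectives [IsArtinianRing Λ] : HasEnoughFiniteInjectives Λ := by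
  intro M _
  obtain ⟨E, φ, hE, hφ⟩ := exists_least_kernel finiteInjective_biprod M
  let ι := kernel.ι φ
  have hom_zero : ∀ E', finiteInjective Λ E' → ∀ f : kernel φ ⟶ E', f = 0 := by
    rintro E' ⟨hE', (_ : Injective E')⟩ f
    rw [← Injective.comp_factorThru f ι]
    exact hφ ι _ ⟨hE', ‹_›⟩ (kernel.condition φ)
  have hcores : HasCoresolution (finiteInjective Λ) (m + 2) (ModuleCat.of Λ Λ) :=
    (hΛ.hasCoresolution.mono fun _ h => ⟨h.1.1, h.2⟩).succ_of_hasInjectiveDimensionLE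
      (inferInstanceAs (Module.Finite Λ Λ)) (hΛ.hasInjectiveDimensionLE _)
  have hK : IsZero (kernel φ) := isZero_of_subsingleton_ext (hΛ.hasProjectiveDimensionLE _)
    fun i hi => hcores.subsingleton_ext inf_le_right hom_zero (Nat.lt_succ_of_le hi)
  exact ⟨E, φ, hE, Preadditive.mono_of_kernel_zero (hK.eq_zero_of_src _)⟩

end IsAuslander

end AuslanderAlgebras

section Indecomposable

variable {Λ : Type v} [Ring Λ]

lemma eq_bot_or_eq_bot_of_isCompl {P : ModuleCat.{v} Λ} (hP : Indecomposable P)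
    {p q : Submodule Λ P} (h : IsCompl p q) : p = ⊥ ∨ q = ⊥ := by
  let e : P ≅ ModuleCat.of Λ p ⊞ ModuleCat.of Λ q :=
    (Submodule.prodEquivOfIsCompl p q h).symm.toModuleIso (X₁ := P) ≪≫
      (ModuleCat.biprodIsoProd (ModuleCat.of Λ p) (ModuleCat.of Λ q)).symm
  simpa only [ModuleCat.isZero_iff_subsingleton, ← Submodule.subsingleton_iff_eq_bot]
    using hP.2 _ _ e

/-- Fitting's lemma. -/
lemma bijective_or_isNilpotent_of_indecomposable {P : ModuleCat.{v} Λ} [IsArtinian Λ P]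
    [IsNoetherian Λ P] (hP : Indecomposable P) (φ : Module.End Λ P) :
    Function.Bijective φ ∨ IsNilpotent φ := by
  obtain ⟨k, hk⟩ := Filter.eventually_atTop.1 φ.eventually_isCompl_ker_pow_range_pow
  rcases eq_bot_or_eq_bot_of_isCompl hP (hk (k + 1) k.le_succ) with hker | hrange
  · refine .inl (IsArtinian.bijective_of_injective_endomorphism φ (LinearMap.ker_eq_bot.1 ?_))
    rw [eq_bot_iff, ← hker, pow_succ]
    exact LinearMap.ker_le_ker_comp _ _
  · exact .inr ⟨k + 1, LinearMap.range_eq_bot.1 hrange⟩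

lemma injective_of_factorization {S P E : ModuleCat.{v} Λ} [IsArtinian Λ P] [IsNoetherian Λ P]
    (hP : Indecomposable P) [Injective E] (ι : S ⟶ E) (g : E ⟶ P) [Mono (ι ≫ g)]
    (hne : ι ≫ g ≠ 0) : Injective P := by
  let h : P ⟶ E := Injective.factorThru ι (ι ≫ g)
  have hfix : (ι ≫ g) ≫ h ≫ g = ι ≫ g := by
    rw [← Category.assoc, Injective.comp_factorThru]
  rcases bijective_or_isNilpotent_of_indecomposable hP (h ≫ g).hom with hbij | ⟨r, hr⟩
  · have : IsIso (h ≫ g) := (ConcreteCategory.isIso_iff_bijective (h ≫ g)).2 hbij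
    exact Retract.injective (Y := E) ⟨h, g ≫ inv (h ≫ g), by
      rw [← Category.assoc, IsIso.hom_inv_id]⟩
  · refine absurd (ModuleCat.hom_ext (LinearMap.ext fun x => ?_)) hne
    have hx : Function.IsFixedPt (h ≫ g).hom ((ι ≫ g).hom x) := congr($(hfix).hom x)
    rw [← (hx.iterate r).eq, ← Module.End.pow_apply, hr]
    rfl

lemma induction_indecomposable [IsArtinianRing Λ] {motive : ModuleCat.{v} Λ → Prop}
    (zero : ∀ M, IsZero M → motive M)
    (indecomposable : ∀ M : ModuleCat.{v} Λ, Module.Finite Λ M → Indecomposable M → motive M)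
    (of_biprod : ∀ M Y Z : ModuleCat.{v} Λ, (M ≅ Y ⊞ Z) → motive Y → motive Z → motive M)
    (M : ModuleCat.{v} Λ) [Module.Finite Λ M] : motive M := by
  induction hl : Module.length Λ M using WellFoundedLT.induction generalizing M with
  | _ l ih =>
    by_cases hM : IsZero M
    · exact zero M hM
    by_cases hM' : Indecomposable M
    · exact indecomposable M ‹_› hM'
    simp only [Indecomposable, hM, not_false_eq_true, true_and, not_forall, not_or] at hM'
    obtain ⟨Y, Z, e, hY, hZ⟩ := hM'
    rw [ModuleCat.isZero_iff_subsingleton, not_subsingleton_iff_nontrivial] at hY hZ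
    have : Module.Finite Λ Y := finite_of_epi (e.hom ≫ biprod.fst)
    have : Module.Finite Λ Z := finite_of_epi (e.hom ≫ biprod.snd)
    have hlen : Module.length Λ Y + Module.length Λ Z = l := by
      rw [← Module.length_prod, ← hl]
      exact (e ≪≫ ModuleCat.biprodIsoProd Y Z).toLinearEquiv.length_eq.symm
    have hYl : Module.length Λ Y < l := by
      rw [← hlen, add_comm]
      exact ENat.lt_add_left Module.length_ne_top Module.length_pos
    have hZl : Module.length Λ Z < l :=
      hlen ▸ ENat.lt_add_left Module.length_ne_top Module.length_pos
    exact of_biprod M Y Z e (ih _ hYl Y rfl) (ih _ hZl Z rfl)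

lemma exists_extension_of_forall_eq_zero [IsArtinianRing Λ] {S Q : ModuleCat.{v} Λ} (ι : S ⟶ Q)
    [Mono ι]
    (hS : ∀ P, finiteProjective Λ P → Indecomposable P → ¬ Injective P → ∀ f : S ⟶ P, f = 0)
    {P : ModuleCat.{v} Λ} (hP : finiteProjective Λ P) (f : S ⟶ P) : ∃ g : Q ⟶ P, ι ≫ g = f := by
  obtain ⟨(_ : Module.Finite Λ P), (_ : Projective P)⟩ := hP
  refine induction_indecomposable (motive := fun P => Projective P →
    ∀ f : S ⟶ P, ∃ g : Q ⟶ P, ι ≫ g = f) ?_ ?_ ?_ P ‹_› f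
  · exact fun M hM _ f => ⟨0, hM.eq_of_tgt _ _⟩
  · intro M hM hM' hMp f
    by_cases hi : Injective M
    · exact ⟨Injective.factorThru f ι, Injective.comp_factorThru f ι⟩
    · exact ⟨0, by rw [hS M ⟨hM, hMp⟩ hM' hi f, comp_zero]⟩
  · intro M Y Z e hY hZ _ f
    have hYp : Projective Y := Retract.projective (Y := M)
      ⟨biprod.inl ≫ e.inv, e.hom ≫ biprod.fst, by simp⟩
    have hZp : Projective Z := Retract.projective (Y := M)
      ⟨biprod.inr ≫ e.inv, e.hom ≫ biprod.snd, by simp⟩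
    obtain ⟨g₁, hg₁⟩ := hY hYp (f ≫ e.hom ≫ biprod.fst)
    obtain ⟨g₂, hg₂⟩ := hZ hZp (f ≫ e.hom ≫ biprod.snd)
    refine ⟨biprod.lift g₁ g₂ ≫ e.inv, ?_⟩
    rw [← Category.assoc, Iso.comp_inv_eq]
    exact biprod.hom_ext _ _ (by simp [hg₁]) (by simp [hg₂])

end Indecomposable

section MaximalOrthogonal

variable {Λ : Type v} [Ring Λ]

namespace IsMaximalOrthogonal

variable {m : ℕ} {𝒞 : ObjectProperty (ModuleCat.{v} Λ)}
  (h : IsMaximalOrthogonal m 𝒞 (finitelyGenerated Λ))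

include h

lemma mem_iff_leftPerp (M : ModuleCat.{v} Λ) : 𝒞 M ↔ leftPerp m 𝒞 M :=
  (iff_of_eq (congrFun h.eq_leftPerp M)).trans ⟨And.left, fun H => ⟨H, H.1⟩⟩

lemma mem_iff_rightPerp (M : ModuleCat.{v} Λ) : 𝒞 M ↔ rightPerp m 𝒞 M :=
  (iff_of_eq (congrFun h.eq_rightPerp M)).trans ⟨And.left, fun H => ⟨H, H.1⟩⟩

lemma finite {M : ModuleCat.{v} Λ} (hM : 𝒞 M) : Module.Finite Λ M :=
  h.le M hM

lemma mem_of_projective (P : ModuleCat.{v} Λ) [hP : Module.Finite Λ P] [Projective P] : 𝒞 P :=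
  (h.mem_iff_leftPerp P).2
    ⟨hP, fun _ _ i hi _ => HasProjectiveDimensionLT.subsingleton _ 1 i hi _⟩

lemma mem_of_injective (E : ModuleCat.{v} Λ) [hE : Module.Finite Λ E] [Injective E] : 𝒞 E :=
  (h.mem_iff_rightPerp E).2
    ⟨hE, fun _ _ i hi _ => HasInjectiveDimensionLT.subsingleton _ 1 i hi _⟩

lemma mem_of_finiteInjective {E : ModuleCat.{v} Λ} : finiteInjective Λ E → 𝒞 E
  | ⟨(_ : Module.Finite Λ E), (_ : Injective E)⟩ => h.mem_of_injective E

lemma subsingleton_ext {X Y : ModuleCat.{v} Λ} (hX : 𝒞 X) (hY : 𝒞 Y) {i : ℕ} (hi : 1 ≤ i)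
    (him : i ≤ m) : Subsingleton (Abelian.Ext X Y i) :=
  ((h.mem_iff_leftPerp X).1 hX).2 Y hY i hi him

lemma injective_of_hasInjectiveDimensionLE (hE : HasEnoughFiniteInjectives Λ)
    {P : ModuleCat.{v} Λ} (hP : 𝒞 P) {k : ℕ} (hk : k ≤ m) (hid : HasInjectiveDimensionLE P k) :
    Injective P := by
  induction k with
  | zero => exact injective_iff_hasInjectiveDimensionLT_one.2 hid
  | succ k ih =>
    exact ih (by lia) <| hE.hasInjectiveDimensionLE_of_subsingleton_ext hid fun E hE' =>
      h.subsingleton_ext (h.mem_of_finiteInjective hE') hP (by lia) hk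

lemma subsingleton_ext_of_hasInjectiveDimensionLE (hE : HasEnoughFiniteInjectives Λ)
    {M P : ModuleCat.{v} Λ} [Module.Finite Λ M] (hP : 𝒞 P) {j k : ℕ} (hj : 1 ≤ j)
    (hjk : j + k ≤ m) (hM : HasInjectiveDimensionLE M k) : Subsingleton (Abelian.Ext M P j) := by
  induction k generalizing M j with
  | zero =>
    have : Injective M := injective_iff_hasInjectiveDimensionLT_one.2 hM
    exact h.subsingleton_ext (h.mem_of_injective M) hP hj hjk
  | succ k ih =>
    obtain ⟨E, f, hE', _⟩ := hE M
    have := h.finite (h.mem_of_finiteInjective hE')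
    have hS := shortExact_cokernel f
    exact subsingleton_ext_from_X₁ hS
      (h.subsingleton_ext (h.mem_of_finiteInjective hE') hP hj (by lia))
      (ih (M := cokernel f) (by lia) (by lia) ((hS.hasInjectiveDimensionLT_X₃_iff k hE'.2).2 hM))

lemma eq_zero_of_hasInjectiveDimensionLE [IsArtinianRing Λ] (hE : HasEnoughFiniteInjectives Λ)
    (hm : 1 ≤ m) {S P : ModuleCat.{v} Λ} [Simple S] (hS : HasInjectiveDimensionLE S m)
    (hP : 𝒞 P) (hP' : Indecomposable P) (hP'' : ¬ Injective P) (f : S ⟶ P) : f = 0 := by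
  by_contra hf
  obtain ⟨k, rfl⟩ := Nat.exists_eq_add_of_le' hm
  have := h.finite hP
  obtain ⟨E, ι, ⟨(_ : Module.Finite Λ E), (_ : Injective E)⟩, _⟩ := hE S
  have hses := shortExact_cokernel ι
  have hext : Subsingleton (Abelian.Ext (cokernel ι) P 1) :=
    h.subsingleton_ext_of_hasInjectiveDimensionLE hE hP le_rfl (by lia)
      ((hses.hasInjectiveDimensionLT_X₃_iff k ‹_›).2 hS)
  obtain ⟨g, rfl⟩ := exists_extension_of_subsingleton_ext_one hses hext f
  have := mono_of_nonzero_from_simple hf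
  exact hP'' (injective_of_factorization hP' ι g hf)

lemma not_injective (hm : 1 ≤ m) [IsNoetherianRing Λ] {M : ModuleCat.{v} Λ} [Module.Finite Λ M]
    (hM : projectiveDimension M = (m : WithBot ℕ∞)) : ¬ Injective M := fun _ =>
  not_subsingleton_ext_of_projectiveDimension_eq hM
    (h.subsingleton_ext (h.mem_of_injective M) (h.mem_of_projective _) hm le_rfl)

/-- The module `P` is the image of a morphism `C ⟶ F` with the least kernel among all morphisms to
finitely generated projectives; it is projective because `Extⁱ(P, Λ) = 0` for `1 ≤ i ≤ m`. -/
lemma exists_projective_quotient [IsArtinianRing Λ] (hΛ : IsAuslander Λ m)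
    {C : ModuleCat.{v} Λ} (hC : 𝒞 C) :
    ∃ (P : ModuleCat.{v} Λ) (π : C ⟶ P), finiteProjective Λ P ∧ Epi π ∧
      ∀ Q, finiteProjective Λ Q → ∀ g : kernel π ⟶ Q, g = 0 := by
  have := h.finite hC
  obtain ⟨F, φ, ⟨-, hF'⟩, hφ⟩ := exists_least_kernel finiteProjective_biprod C
  let π := Abelian.factorThruImage φ
  have hπφ : kernel.ι π ≫ φ = 0 := by
    have : kernel.ι π ≫ π ≫ Abelian.image.ι φ = 0 := by rw [kernel.condition_assoc, zero_comp]
    rwa [Abelian.image.fac] at this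
  have hΛ₀ : Subsingleton (Abelian.Ext (kernel π) (ModuleCat.of Λ Λ) 0) :=
    subsingleton_ext_zero_iff.2 fun g => by
      obtain ⟨E, f, ⟨hE, (_ : Injective E)⟩, _⟩ := hΛ.hasCoresolution.exists_mono
      refine zero_of_comp_mono f ?_
      rw [← Injective.comp_factorThru (g ≫ f) (kernel.ι π)]
      exact hφ _ _ hE hπφ
  have hK : ∀ Q, finiteProjective Λ Q → ∀ g : kernel π ⟶ Q, g = 0 := by
    rintro Q ⟨(_ : Module.Finite Λ Q), (_ : Projective Q)⟩
    exact subsingleton_ext_zero_iff.1 (subsingleton_ext_projective hΛ₀ Q)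
  have hfin : Module.Finite Λ (Abelian.image φ : ModuleCat.{v} Λ) := finite_of_epi π
  have hpd : HasProjectiveDimensionLE (Abelian.image φ) m :=
    ((shortExact_cokernel (Abelian.image.ι φ)).hasProjectiveDimensionLT_X₃_iff m hF').1
      (hΛ.hasProjectiveDimensionLE _)
  have hproj : Projective (Abelian.image φ) := by
    refine projective_of_subsingleton_ext hpd fun i hi him => ?_
    obtain ⟨i, rfl⟩ := Nat.exists_eq_add_of_le' hi
    refine subsingleton_ext_from_X₃ (shortExact_kernel π) ?_
      (h.subsingleton_ext hC (h.mem_of_projective _) hi him)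
    exact hΛ.hasCoresolution.subsingleton_ext inf_le_right (fun Q hQ => hK Q hQ.1) (by lia)
  exact ⟨_, π, ⟨hfin, hproj⟩, inferInstance, hK⟩

lemma mono_of_isLeftApproximation (hE : HasEnoughFiniteInjectives Λ) {Z C : ModuleCat.{v} Λ}
    [Module.Finite Λ Z] {f : Z ⟶ C} (hf : IsLeftApproximation 𝒞 f) : Mono f := by
  obtain ⟨E, e, hE', _⟩ := hE Z
  obtain ⟨g, rfl⟩ := hf.2 E (h.mem_of_finiteInjective hE') e
  exact mono_of_mono f g

lemma subsingleton_ext_cokernel {Z C : ModuleCat.{v} Λ} {f : Z ⟶ C} [Mono f]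
    (hf : IsLeftApproximation 𝒞 f) {j : ℕ} (hj : j < m)
    (hZ : ∀ X, 𝒞 X → ∀ i, 1 ≤ i → i ≤ j → Subsingleton (Abelian.Ext Z X i)) :
    ∀ X, 𝒞 X → ∀ i, 1 ≤ i → i ≤ j + 1 → Subsingleton (Abelian.Ext (cokernel f) X i) := by
  intro X hX i hi hij
  have hS := shortExact_cokernel f
  have hCX := h.subsingleton_ext hf.1 hX hi (by lia)
  obtain ⟨i, rfl⟩ := Nat.exists_eq_add_of_le' hi
  cases i with
  | zero => exact subsingleton_ext_one_of_extension hS (hf.2 X hX) hCX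
  | succ i => exact subsingleton_ext_from_X₃ hS (hZ X hX _ (by lia) (by lia)) hCX

/-- Each left `𝒞`-approximation trades one degree of `Ext(Z, 𝒞) = 0` for one of `Ext(𝒞, Z) = 0`. -/
lemma subsingleton_ext_of_forall (hE : HasEnoughFiniteInjectives Λ) {X : ModuleCat.{v} Λ}
    (hX : 𝒞 X) {j d : ℕ} (hj : 1 ≤ j) (hjd : j + d = m) {Z : ModuleCat.{v} Λ}
    [hZf : Module.Finite Λ Z]
    (hZ : ∀ C, 𝒞 C → ∀ i, 1 ≤ i → i ≤ j → Subsingleton (Abelian.Ext Z C i)) :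
    Subsingleton (Abelian.Ext X Z (d + 1)) := by
  induction d generalizing j Z with
  | zero =>
    obtain rfl : j = m := hjd
    exact h.subsingleton_ext hX ((h.mem_iff_leftPerp Z).2 ⟨hZf, hZ⟩) le_rfl hj
  | succ d ih =>
    obtain ⟨⟨C, f, hf⟩, -⟩ := h.functoriallyFinite Z hZf
    have := h.mono_of_isLeftApproximation hE hf
    have := h.finite hf.1
    exact subsingleton_ext_to_X₁ (shortExact_cokernel f)
      (ih (by lia) (by lia) (h.subsingleton_ext_cokernel hf (by lia) hZ))
      (h.subsingleton_ext hX hf.1 (by lia) (by lia))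

lemma isLeftApproximation_of_forall_eq_zero [IsArtinianRing Λ] (hΛ : IsAuslander Λ m)
    {S Q : ModuleCat.{v} Λ} [Simple S] (hQ : finiteProjectiveInjective Λ Q) (ι : S ⟶ Q) [Mono ι]
    (hS : ∀ P, finiteProjective Λ P → Indecomposable P → ¬ Injective P → ∀ f : S ⟶ P, f = 0) :
    IsLeftApproximation 𝒞 ι := by
  obtain ⟨⟨hQf, (_ : Projective Q)⟩, (_ : Injective Q)⟩ := hQ
  refine ⟨h.mem_of_injective Q (hE := hQf), fun C hC f => ?_⟩
  obtain ⟨P, π, hP, _, hK⟩ := h.exists_projective_quotient hΛ hC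
  obtain ⟨g, hg⟩ := exists_extension_of_forall_eq_zero ι hS hP (f ≫ π)
  let g' : Q ⟶ C := Projective.factorThru g π
  have hg' : (f - ι ≫ g') ≫ π = 0 := by
    simp only [g', Preadditive.sub_comp, Category.assoc, Projective.factorThru_comp, hg, sub_self]
  let u : S ⟶ kernel π := kernel.lift π (f - ι ≫ g') hg'
  have hu : u = 0 := by
    by_contra hne
    have := mono_of_nonzero_from_simple hne
    have hι : ι = 0 := by
      rw [← Injective.comp_factorThru ι u, hK Q ⟨hQf, ‹_›⟩ (Injective.factorThru ι u), comp_zero]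
    exact hne ((IsZero.of_mono_eq_zero ι hι).eq_zero_of_src u)
  refine ⟨g', (sub_eq_zero.1 ?_).symm⟩
  rw [← kernel.lift_ι π _ hg']
  exact (congrArg (· ≫ kernel.ι π) hu).trans zero_comp

lemma hasInjectiveDimensionLE_of_forall_eq_zero [IsArtinianRing Λ] (hm : 1 ≤ m)
    (hΛ : IsAuslander Λ m) {S : ModuleCat.{v} Λ} [Simple S] [Module.Finite Λ S]
    (hpd : projectiveDimension S = (m : WithBot ℕ∞))
    (hS : ∀ P, finiteProjective Λ P → Indecomposable P → ¬ Injective P → ∀ f : S ⟶ P, f = 0) :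
    HasInjectiveDimensionLE S m := by
  have hE := hΛ.hasEnoughFiniteInjectives
  obtain ⟨Q, hQ, ι, hι⟩ : ∃ Q, finiteProjectiveInjective Λ Q ∧ ∃ ι : S ⟶ Q, ι ≠ 0 := by
    by_contra! hzero
    exact not_subsingleton_ext_of_projectiveDimension_eq hpd
      (hΛ.hasCoresolution.subsingleton_ext inf_le_right hzero m.lt_succ_self)
  have := mono_of_nonzero_from_simple hι
  have hQf : Module.Finite Λ Q := hQ.1.1
  have hQi : Injective Q := hQ.2
  have happrox := h.isLeftApproximation_of_forall_eq_zero hΛ hQ ι hS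
  have hcoker := h.subsingleton_ext_cokernel happrox hm fun _ _ i hi hi' => by lia
  obtain ⟨k, rfl⟩ := Nat.exists_eq_add_of_le' hm
  refine hE.hasInjectiveDimensionLE_of_subsingleton_ext (hΛ.hasInjectiveDimensionLE S)
    fun E hE' => ?_
  exact subsingleton_ext_to_X₁ (shortExact_cokernel ι)
    (h.subsingleton_ext_of_forall hE (h.mem_of_finiteInjective hE') le_rfl (add_comm 1 k)
      (Z := cokernel ι) hcoker)
    (Abelian.Ext.subsingleton_of_injective _ _ _)

lemma hasInjectiveDimensionLE_iff [IsArtinianRing Λ] (hm : 1 ≤ m) (hΛ : IsAuslander Λ m)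
    {S : ModuleCat.{v} Λ} [Simple S] [Module.Finite Λ S]
    (hpd : projectiveDimension S = (m : WithBot ℕ∞)) :
    HasInjectiveDimensionLE S m ↔
      ∀ P : ModuleCat.{v} Λ, Module.Finite Λ P → Projective P → Indecomposable P →
        injectiveDimension P = ((m + 1 : ℕ) : WithBot ℕ∞) → ∀ f : S ⟶ P, f = 0 := by
  have hE := hΛ.hasEnoughFiniteInjectives
  refine ⟨fun hid P _ _ hP hPid => ?_, fun hS => ?_⟩
  · refine h.eq_zero_of_hasInjectiveDimensionLE hE hm hid (h.mem_of_projective P) hP fun _ => ?_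
    exact (hΛ.injectiveDimension_eq_iff P).1 hPid (hasInjectiveDimensionLT_of_ge P 1 _ (by simp))
  · refine h.hasInjectiveDimensionLE_of_forall_eq_zero hm hΛ hpd ?_
    rintro P ⟨(hPf : Module.Finite Λ P), (hPp : Projective P)⟩ hP hPi
    refine hS P hPf hPp hP ((hΛ.injectiveDimension_eq_iff P).2 fun hid => hPi ?_)
    exact h.injective_of_hasInjectiveDimensionLE hE (h.mem_of_projective P) le_rfl hid

end IsMaximalOrthogonal

end MaximalOrthogonal

lemma one_le_injectiveDimension_iff {C : Type*} [Category* C] [Abelian C] {M : C} :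
    1 ≤ injectiveDimension M ↔ ¬ Injective M := by
  rw [injective_iff_hasInjectiveDimensionLT_one, ← injectiveDimension_ge_iff, Nat.cast_one]

end HigherAuslander

end

theorem theorem3p8_general {Λ : Type v} [Ring Λ] [IsArtinianRing Λ] {m : ℕ} (hm : 1 ≤ m)
    (hΛ : HigherAuslander.IsAuslander Λ m) (𝒞 : ObjectProperty (ModuleCat.{v} Λ))
    (h𝒞 : HigherAuslander.IsMaximalOrthogonal m 𝒞 (HigherAuslander.finitelyGenerated Λ))
    (S : ModuleCat.{v} Λ) [IsSimpleModule Λ S]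
    (hS : projectiveDimension S = (m : WithBot ℕ∞)) :
    ¬ Injective S ∧
    ((1 ≤ injectiveDimension S ∧ injectiveDimension S ≤ (m : WithBot ℕ∞)) ↔
      ∀ P : ModuleCat.{v} Λ, Module.Finite Λ P → Projective P → Indecomposable P →
        injectiveDimension P = ((m + 1 : ℕ) : WithBot ℕ∞) → ∀ f : S ⟶ P, f = 0) ∧
    (injectiveDimension S = ((m + 1 : ℕ) : WithBot ℕ∞) ↔
      ∃ P : ModuleCat.{v} Λ, Module.Finite Λ P ∧ Projective P ∧ Indecomposable P ∧
        injectiveDimension P = ((m + 1 : ℕ) : WithBot ℕ∞) ∧ ∃ f : S ⟶ P, f ≠ 0) := by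
  have : Simple S := (simple_iff_isSimpleModule' S).2 ‹_›
  have hinj : ¬ Injective S := h𝒞.not_injective hm hS
  have hid := h𝒞.hasInjectiveDimensionLE_iff hm hΛ hS
  refine ⟨hinj, ?_, ?_⟩
  · rw [← hid, injectiveDimension_le_iff]
    exact and_iff_right (HigherAuslander.one_le_injectiveDimension_iff.2 hinj)
  · rw [hΛ.injectiveDimension_eq_iff, hid]
    push Not
    rfl

theorem theorem3p8 {R : Type u} [CommRing R] [IsArtinianRing R]
    {Λ : Type v} [Ring Λ] [Algebra R Λ] [Module.Finite R Λ]
    (n : ℕ) (hn : 2 ≤ n)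
    (hΛ : HigherAuslander.IsAuslander Λ (n - 1))
    (hgd : HigherAuslander.globalDimension Λ = (n : WithBot ℕ∞))
    (𝒞 : ObjectProperty (ModuleCat.{v} Λ))
    (h𝒞 : HigherAuslander.IsMaximalOrthogonal (n - 1) 𝒞 (HigherAuslander.finitelyGenerated Λ))
    (S : ModuleCat.{v} Λ) [IsSimpleModule Λ S]
    (hS : projectiveDimension S = ((n - 1 : ℕ) : WithBot ℕ∞)) :
    ¬ Injective S ∧
    ((1 ≤ injectiveDimension S ∧ injectiveDimension S ≤ ((n - 1 : ℕ) : WithBot ℕ∞)) ↔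
      ∀ P : ModuleCat.{v} Λ, Module.Finite Λ P → Projective P → Indecomposable P →
        injectiveDimension P = (n : WithBot ℕ∞) → ∀ f : S ⟶ P, f = 0) ∧
    (injectiveDimension S = (n : WithBot ℕ∞) ↔
      ∃ P : ModuleCat.{v} Λ, Module.Finite Λ P ∧ Projective P ∧ Indecomposable P ∧
        injectiveDimension P = (n : WithBot ℕ∞) ∧ ∃ f : S ⟶ P, f ≠ 0) := by
  have : IsArtinianRing Λ := isArtinian_of_tower R inferInstance
  obtain ⟨k, rfl⟩ := Nat.exists_eq_add_of_le' hn
  exact theorem3p8_general k.succ_pos hΛ 𝒞 h𝒞 S hS
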